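/- Let $G=(V,E)$ be a finite simple graph on $n$ vertices with at least one edge. For a real number $k\ge 2$, a vector $k$-coloring of $G$ is an assignment of unit vectors $u_i\in\mathbb{R}^n$ to the vertices $i\in V$ such that $\langle u_i,u_j\rangle\le -\frac{1}{k-1}$ whenever $i$ and $j$ are adjacent; the vector chromatic number $\chi_v(G)$ is the smallest real $k\ge 2$ for which a vector $k$-coloring exists (this minimum is attained). Then $$\chi_v(G)=1+\max_W\frac{\sum_{i\ne j}w_{ij}}{\operatorname{tr}(W)-n\lambda_{\min}(W)},$$ where the sum is over ordered pairs $(i,j)$ with $i\neq j$, $\lambda_{\min}(W)$ is the minimum eigenvalue of $W$, and the maximum, which is attained, is over all real symmetric matrices $W=(w_{ij})_{i,j\in V}$ with non-negative entries, with $w_{ij}=0$ whenever $i$ and $j$ are distinct and non-adjacent, and with $\operatorname{tr}(W)\ne n\lambda_{\min}(W)$ (that is, $W$ is not a multiple of the identity). In particular, let $Q=D+A$ be the signless Laplacian of $G$, where $D$ is the diagonal matrix of vertex degrees and $A$ is the adjacency matrix. Then $W=Q$ is such a matrix; with $m$ the number of edges and $\delta_n$ the minimum eigenvalue of $Q$,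 the quotient for $W=Q$ equals $\frac{2m}{2m-n\delta_n}$, so that $$1+\frac{2m}{2m-n\delta_n}\le\chi_v(G).$$ -/

import Mathlib

namespace SimpleGraph

variable {V : Type*} [Fintype V]

/-- `u` is a vector `k`-coloring of `G`: unit vectors in `ℝⁿ`, `n = |V|`, such that
`⟨uᵢ, uⱼ⟩ ≤ -1 / (k - 1)` for all adjacent `i`, `j`. Used for real `k ≥ 2` only. -/
structure IsVectorColoring (G : SimpleGraph V) (k : ℝ)
    (u : V → EuclideanSpace ℝ (Fin (Fintype.card V))) : Prop where
  norm_eq_one : ∀ i, ‖u i‖ = 1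
  inner_le : ∀ i j, G.Adj i j → inner ℝ (u i) (u j) ≤ -(1 / (k - 1))

/-- The real number `k` is at least `2` and `G` has a vector `k`-coloring. -/
def VectorColorable (G : SimpleGraph V) (k : ℝ) : Prop :=
  2 ≤ k ∧ ∃ u : V → EuclideanSpace ℝ (Fin (Fintype.card V)), G.IsVectorColoring k u

/-- The vector chromatic number: the smallest real `k ≥ 2` for which there is a vector
`k`-coloring. -/
noncomputable def vectorChromaticNumber (G : SimpleGraph V) : ℝ :=
  sInf {k : ℝ | G.VectorColorable k}

/-- `W` is a non-negative weight matrix of `G`: real symmetric, entrywise non-negative, and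
zero at all pairs of distinct non-adjacent vertices (the diagonal is otherwise free). -/
structure IsNonnegWeightMatrix {V : Type*} (G : SimpleGraph V) (W : Matrix V V ℝ) : Prop where
  isSymm : W.IsSymm
  nonneg : ∀ i j, 0 ≤ W i j
  eq_zero : ∀ i j, i ≠ j → ¬ G.Adj i j → W i j = 0

/-- The signless Laplacian `Q = D + A`. -/
def signlessLapMatrix [DecidableEq V] (G : SimpleGraph V) [DecidableRel G.Adj] : Matrix V V ℝ :=
  G.degMatrix ℝ + G.adjMatrix ℝ

end SimpleGraph

namespace Matrix

variable {V : Type*} [Fintype V] [DecidableEq V]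

/-- The minimum eigenvalue of a real symmetric matrix (of positive size). -/
noncomputable def minEigenvalue (W : Matrix V V ℝ) : ℝ :=
  sInf {μ : ℝ | Module.End.HasEigenvalue (Matrix.toLin' W) μ}

/-- `tr(W) - n λ_min(W)`. -/
noncomputable def traceGap (W : Matrix V V ℝ) : ℝ :=
  W.trace - (Fintype.card V : ℝ) * W.minEigenvalue

/-- `(∑_{i ≠ j} w_ij) / (tr(W) - n λ_min(W))`, the sum being over ordered pairs. -/
noncomputable def weightRatio (W : Matrix V V ℝ) : ℝ :=
  (∑ p ∈ (Finset.univ : Finset V).offDiag, W p.1 p.2) / W.traceGap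

end Matrix

/-!
The formula is semidefinite duality. Say that `X` is a Gram matrix when it is positive semidefinite
with unit diagonal; vector `k`-colorings are then the Gram matrices with `X i j ≤ -1 / (k - 1)` on
the edges.

*Weak duality* (`IsNonnegWeightMatrix.offDiag_sum_le`). For a weight matrix `W` the matrix
`W - λ_min(W) • 1` is positive semidefinite, so its pairing with a Gram matrix `X` is non-negative.
The diagonal contributes exactly `tr W - n λ_min(W)` and the off-diagonal part at most
`-1 / (k - 1) * ∑_{i ≠ j} w_ij`, which bounds the quotient by `k - 1`.

*Strong duality* (`exists_posSemidef_weight`). Let `t = -1 / (χ - 1)`, where `χ` is the vector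
chromatic number. No positive semidefinite `X` has diagonal entries `< 1` and edge entries `< t`:
raising the diagonal to `1` keeps `X` positive semidefinite, so that `X` would give a coloring with
fewer than `χ` colors. The matrices with diagonal entries `< 1` and edge entries `< t` form an open
convex set, so Hahn-Banach separates it from the cone of positive semidefinite matrices. Since the
open set is unbounded in the relevant directions, the separating functional is non-negative on the
diagonal and on the edges and vanishes elsewhere; since it is non-negative on the cone, its
symmetrized coefficient matrix `W` is positive semidefinite. So `W` is a weight matrix with
`λ_min(W) ≥ 0`, and comparing the functional at the corner of the open set with `0` gives
`tr W ≤ -t ∑_{i ≠ j} w_ij`, hence with quotient at least `χ - 1`. The diagonal of `W`, free in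
the theorem, plays the part of the dual variables of the unit-length constraints.

The vector chromatic number is attained because the pairs of a number `k` and a vector `k`-coloring
form a closed set, which is projected to the `k`-axis along a compact product of spheres.
-/

open Finset Matrix

namespace Matrix

variable {V : Type*} [Fintype V]

/-! ### Sums of matrix entries, least eigenvalue and trace gap -/

lemma PosSemidef.sum_mul_nonneg {M : Matrix V V ℝ} (hM : M.PosSemidef) (x : V → ℝ) :
    0 ≤ ∑ i, ∑ j, M i j * (x i * x j) := by
  have h := hM.dotProduct_mulVec_nonneg x
  simp only [dotProduct, mulVec, star_trivial, mul_sum] at h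
  refine h.trans_eq (sum_congr rfl fun i _ ↦ sum_congr rfl fun j _ ↦ ?_)
  ring

lemma PosSemidef.of_sum_mul_nonneg {M : Matrix V V ℝ} (hM : M.IsSymm)
    (h : ∀ x : V → ℝ, 0 ≤ ∑ i, ∑ j, M i j * (x i * x j)) : M.PosSemidef := by
  refine .of_dotProduct_mulVec_nonneg ?_ fun x ↦ ?_
  · rwa [IsHermitian, conjTranspose_eq_transpose_of_trivial]
  · simp only [dotProduct, mulVec, star_trivial, mul_sum]
    refine (h x).trans_eq (sum_congr rfl fun i _ ↦ sum_congr rfl fun j _ ↦ ?_)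
    ring

lemma PosSemidef.sum_mul_inner_nonneg {M : Matrix V V ℝ} (hM : M.PosSemidef) {ι : Type*}
    [Fintype ι] (u : V → EuclideanSpace ℝ ι) :
    0 ≤ ∑ i, ∑ j, M i j * inner ℝ (u i) (u j) := by
  have h : ∑ i, ∑ j, M i j * inner ℝ (u i) (u j) =
      ∑ l, ∑ i, ∑ j, M i j * (u i l * u j l) := by
    rw [sum_comm (s := (univ : Finset ι))]
    refine sum_congr rfl fun i _ ↦ ?_
    rw [sum_comm]
    refine sum_congr rfl fun j _ ↦ ?_
    simp [PiLp.inner_apply, mul_sum, mul_comm]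
  rw [h]
  exact sum_nonneg fun l _ ↦ hM.sum_mul_nonneg fun i ↦ u i l

variable [DecidableEq V]

lemma sum_sum_eq_sum_diag_add_sum_offDiag (f : V → V → ℝ) :
    ∑ i, ∑ j, f i j = ∑ i, f i i + ∑ p ∈ (univ : Finset V).offDiag, f p.1 p.2 := by
  have h : (univ : Finset (V × V)) = univ.diag ∪ univ.offDiag := by
    rw [diag_union_offDiag, univ_product_univ]
  rw [← Fintype.sum_prod_type', h, sum_union (disjoint_diag_offDiag _), sum_diag]

lemma PosSemidef.minEigenvalue_nonneg {W : Matrix V V ℝ} (hW : W.PosSemidef) :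
    0 ≤ W.minEigenvalue := by
  refine Real.sInf_nonneg fun μ hμ ↦ ?_
  obtain ⟨v, hv⟩ := hμ.exists_hasEigenvector
  have h1 : W *ᵥ v = μ • v := by simpa using hv.apply_eq_smul
  have h2 := hW.dotProduct_mulVec_nonneg v
  rw [h1, dotProduct_smul, star_trivial, smul_eq_mul] at h2
  have h3 : 0 < v ⬝ᵥ v :=
    (by simpa using dotProduct_star_self_nonneg v : 0 ≤ v ⬝ᵥ v).lt_of_ne' fun h ↦
      hv.2 (dotProduct_self_eq_zero.1 h)
  exact nonneg_of_mul_nonneg_left h2 h3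

lemma IsSymm.posSemidef_sub_minEigenvalue {W : Matrix V V ℝ} (hW : W.IsSymm) :
    (W - W.minEigenvalue • (1 : Matrix V V ℝ)).PosSemidef := by
  have hH : (W - W.minEigenvalue • (1 : Matrix V V ℝ)).IsHermitian := by
    rw [IsHermitian, conjTranspose_eq_transpose_of_trivial]
    simp [hW.eq]
  rw [hH.posSemidef_iff_eigenvalues_nonneg]
  intro i
  have h1 := hH.mulVec_eigenvectorBasis i
  rw [sub_mulVec, smul_mulVec, one_mulVec, sub_eq_iff_eq_add, ← add_smul] at h1
  have h2 : Module.End.HasEigenvalue (toLin' W) (hH.eigenvalues i + W.minEigenvalue) := by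
    refine Module.End.hasEigenvalue_of_hasEigenvector
      (x := (hH.eigenvectorBasis i : V → ℝ)) ⟨?_, fun h0 ↦ ?_⟩
    · rw [Module.End.mem_eigenspace_iff, toLin'_apply]
      exact h1
    · refine hH.eigenvectorBasis.orthonormal.ne_zero i ?_
      ext j
      exact congrFun h0 j
  have h3 : W.minEigenvalue ≤ _ := csInf_le (Module.End.finite_hasEigenvalue _).bddBelow h2
  simpa using h3

lemma trace_sub_minEigenvalue (W : Matrix V V ℝ) :
    (W - W.minEigenvalue • (1 : Matrix V V ℝ)).trace = W.traceGap := by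
  simp [traceGap, trace_sub, trace_smul, trace_one, mul_comm]

lemma IsSymm.traceGap_nonneg {W : Matrix V V ℝ} (hW : W.IsSymm) : 0 ≤ W.traceGap := by
  rw [← trace_sub_minEigenvalue]
  exact hW.posSemidef_sub_minEigenvalue.trace_nonneg

/-- The trace gap is the trace of the positive semidefinite matrix `W - λ_min(W) • 1`, so it
vanishes only if `W` is a multiple of the identity. -/
lemma IsSymm.traceGap_pos {W : Matrix V V ℝ} (hW : W.IsSymm) {i j : V} (hij : i ≠ j)
    (h : W i j ≠ 0) : 0 < W.traceGap := by
  refine hW.traceGap_nonneg.lt_of_ne' fun h0 ↦ h ?_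
  rw [← trace_sub_minEigenvalue, hW.posSemidef_sub_minEigenvalue.trace_eq_zero_iff] at h0
  simpa [hij] using congrFun (congrFun h0 i) j

lemma apply_eq_sum_sum (f : StrongDual ℝ (V → V → ℝ)) (X : V → V → ℝ) :
    f X = ∑ i, ∑ j, f (Pi.single i (Pi.single j 1)) * X i j := by
  have h : X = ∑ i, ∑ j, X i j • (Pi.single i (Pi.single j 1) : V → V → ℝ) := by
    ext a b
    simp [Finset.sum_apply, Pi.single_apply, apply_ite, ite_apply]
  conv_lhs => rw [h]
  simp [mul_comm]

end Matrix

namespace SimpleGraph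

variable {V : Type*} [Fintype V] {G : SimpleGraph V}

/-! ### The set of admissible numbers of colors is closed -/

lemma vectorColorable_iff_exists_mul_inner_le {k : ℝ} (hk : 2 ≤ k) : G.VectorColorable k ↔
    ∃ u : V → Metric.sphere (0 : EuclideanSpace ℝ (Fin (Fintype.card V))) 1,
      ∀ i j, G.Adj i j → inner ℝ (u i).1 (u j).1 * (k - 1) ≤ -1 := by
  have h : ∀ x : ℝ, x ≤ -(1 / (k - 1)) ↔ x * (k - 1) ≤ -1 := fun x ↦ by
    rw [← neg_div, le_div_iff₀ (by linarith)]
  constructor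
  · rintro ⟨-, u, hu⟩
    exact ⟨fun i ↦ ⟨u i, by simpa using hu.norm_eq_one i⟩,
      fun i j hij ↦ (h _).1 (hu.inner_le i j hij)⟩
  · rintro ⟨u, hu⟩
    exact ⟨hk, fun i ↦ u i, fun i ↦ by simp, fun i j hij ↦ (h _).2 (hu i j hij)⟩

lemma isClosed_setOf_vectorColorable : IsClosed {k : ℝ | G.VectorColorable k} := by
  -- The set is the projection of a closed set along a compact product of spheres.
  have h : {k : ℝ | G.VectorColorable k} = Prod.fst ''
      {q : ℝ × (V → Metric.sphere (0 : EuclideanSpace ℝ (Fin (Fintype.card V))) 1) |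
        2 ≤ q.1 ∧ ∀ i j, G.Adj i j →
          inner ℝ (q.2 i).1 (q.2 j).1 * (q.1 - 1) ≤ -1} := by
    ext k
    simp only [Set.mem_ofPred_eq, Set.mem_image, Prod.exists, exists_and_right, exists_eq_right]
    constructor
    · intro hk
      obtain ⟨u, hu⟩ := (vectorColorable_iff_exists_mul_inner_le hk.1).1 hk
      exact ⟨u, hk.1, hu⟩
    · rintro ⟨u, hk, hu⟩
      exact (vectorColorable_iff_exists_mul_inner_le hk).2 ⟨u, hu⟩
  rw [h]
  refine isClosedMap_fst_of_compactSpace _ ?_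
  simp only [Set.ofPred_and, Set.ofPred_forall]
  refine (isClosed_le continuous_const continuous_fst).inter <|
    isClosed_iInter fun i ↦ isClosed_iInter fun j ↦ isClosed_iInter fun _ ↦
      isClosed_le ?_ continuous_const
  fun_prop

/-! ### Vector colorings and Gram matrices -/

variable [DecidableEq V]

/-- A positive semidefinite matrix of size `n` is the Gram matrix of vectors in `ℝⁿ`. -/
lemma exists_inner_eq_of_posSemidef {X : Matrix V V ℝ} (hX : X.PosSemidef) :
    ∃ u : V → EuclideanSpace ℝ (Fin (Fintype.card V)), ∀ i j, inner ℝ (u i) (u j) = X i j := by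
  obtain ⟨B, rfl⟩ : ∃ B : Matrix V V ℝ, X = Bᴴ * B := by
    open scoped MatrixOrder ComplexOrder in
    exact CStarAlgebra.nonneg_iff_eq_star_mul_self.1 (nonneg_iff_posSemidef.2 hX)
  refine ⟨fun i ↦ WithLp.toLp 2 fun l ↦ B ((Fintype.equivFin V).symm l) i, fun i j ↦ ?_⟩
  simp only [PiLp.inner_apply, mul_apply, conjTranspose_apply, star_trivial]
  rw [← (Fintype.equivFin V).symm.sum_comp]
  simp [mul_comm]

lemma vectorColorable_of_posSemidef {X : Matrix V V ℝ} (hX : X.PosSemidef)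
    (hdiag : ∀ i, X i i = 1) {k : ℝ} (hk : 2 ≤ k)
    (hadj : ∀ i j, G.Adj i j → X i j ≤ -(1 / (k - 1))) : G.VectorColorable k := by
  obtain ⟨u, hu⟩ := exists_inner_eq_of_posSemidef hX
  exact ⟨hk, u, fun i ↦ by rw [norm_eq_sqrt_real_inner, hu, hdiag, Real.sqrt_one],
    fun i j hij ↦ (hu i j).trans_le (hadj i j hij)⟩

/-- Raising the diagonal of a positive semidefinite matrix to `1` turns edge entries `< t` into a
vector coloring with fewer than `1 - 1 / t` colors. -/
lemma exists_vectorColorable_lt {X : Matrix V V ℝ} (hX : X.PosSemidef)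
    (hdiag : ∀ i, X i i < 1) {a b : V} (hab : G.Adj a b) {t : ℝ} (ht : t < 0)
    (hadj : ∀ i j, G.Adj i j → X i j < t) : ∃ k < 1 - 1 / t, G.VectorColorable k := by
  classical
  -- `s` is the largest edge entry; it is negative, and at least `-1` by Cauchy-Schwarz.
  obtain ⟨p, hp, hmax⟩ := (univ.filter fun p : V × V ↦ G.Adj p.1 p.2).exists_max_image
    (fun p ↦ X p.1 p.2) ⟨(a, b), by simpa⟩
  simp only [mem_filter, mem_univ, true_and] at hp hmax
  set s := X p.1 p.2
  have hst : s < t := hadj _ _ hp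
  set Y : Matrix V V ℝ := X + diagonal fun i ↦ 1 - X i i with hY
  have hYpos : Y.PosSemidef := hX.add (.diagonal fun i ↦ sub_nonneg.2 (hdiag i).le)
  have hYdiag : ∀ i, Y i i = 1 := fun i ↦ by simp [hY]
  have hYoff : ∀ i j, i ≠ j → Y i j = X i j := fun i j h ↦ by simp [hY, h]
  have hs1 : -1 ≤ s := by
    obtain ⟨u, hu⟩ := exists_inner_eq_of_posSemidef hYpos
    have h1 : ∀ i, ‖u i‖ = 1 := fun i ↦ by
      rw [norm_eq_sqrt_real_inner, hu, hYdiag, Real.sqrt_one]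
    have h2 := (abs_le.1 (abs_real_inner_le_norm (u p.1) (u p.2))).1
    rwa [hu, hYoff _ _ hp.ne, h1, h1, mul_one] at h2
  have hs0 : s < 0 := hst.trans ht
  have hinv : 1 ≤ -(1 / s) := by
    rw [← one_div_neg_eq_neg_one_div, le_div_iff₀ (by linarith)]
    linarith
  refine ⟨1 - 1 / s, ?_, vectorColorable_of_posSemidef hYpos hYdiag (by linarith)
    fun i j hij ↦ ?_⟩
  · have := one_div_lt_one_div_of_neg_of_lt ht hst
    linarith
  · rw [hYoff _ _ hij.ne]
    refine (hmax (i, j) hij).trans_eq ?_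
    rw [sub_sub_cancel_left, one_div_neg_eq_neg_one_div, neg_neg, one_div_one_div]

/-- The Gram matrix of the regular simplex, `1 / (n - 1)` times the Laplacian of the complete
graph, gives a vector `n`-coloring. -/
lemma vectorColorable_card (hG : G ≠ ⊥) : G.VectorColorable (Fintype.card V) := by
  obtain ⟨a, b, hab⟩ := ne_bot_iff_exists_adj.1 hG
  have hn : 2 ≤ Fintype.card V := Fintype.one_lt_card_iff.2 ⟨a, b, hab.ne⟩
  have hn' : (2 : ℝ) ≤ Fintype.card V := by exact_mod_cast hn
  have hpos : (0 : ℝ) < Fintype.card V - 1 := by linarith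
  refine vectorColorable_of_posSemidef (X := ((Fintype.card V : ℝ) - 1)⁻¹ •
    (⊤ : SimpleGraph V).lapMatrix ℝ) (((⊤ : SimpleGraph V).posSemidef_lapMatrix ℝ).smul
      (inv_nonneg.2 hpos.le)) (fun i ↦ ?_) hn' fun i j hij ↦ ?_
  · have h1 : ((Fintype.card V - 1 : ℕ) : ℝ) = Fintype.card V - 1 := by
      rw [Nat.cast_sub (by omega), Nat.cast_one]
    simp [lapMatrix, degMatrix, h1, hpos.ne']
  · simp [lapMatrix, degMatrix, hij.ne]

lemma isLeast_vectorChromaticNumber (hG : G ≠ ⊥) :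
    IsLeast {k : ℝ | G.VectorColorable k} G.vectorChromaticNumber :=
  isClosed_setOf_vectorColorable.isLeast_csInf ⟨_, vectorColorable_card hG⟩ ⟨2, fun _ hk ↦ hk.1⟩

/-! ### Weak duality -/

lemma IsNonnegWeightMatrix.offDiag_sum_le {W : Matrix V V ℝ} (hW : G.IsNonnegWeightMatrix W)
    {k : ℝ} (hk : G.VectorColorable k) :
    ∑ p ∈ (univ : Finset V).offDiag, W p.1 p.2 ≤ (k - 1) * W.traceGap := by
  obtain ⟨hk2, u, hu⟩ := hk
  have hk0 : 0 < k - 1 := by linarith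
  have h := hW.isSymm.posSemidef_sub_minEigenvalue.sum_mul_inner_nonneg u
  rw [sum_sum_eq_sum_diag_add_sum_offDiag
    (fun i j ↦ (W - W.minEigenvalue • (1 : Matrix V V ℝ)) i j * inner ℝ (u i) (u j))] at h
  simp only [real_inner_self_eq_norm_sq, hu.norm_eq_one, one_pow, mul_one] at h
  have htr : ∑ i, (W - W.minEigenvalue • (1 : Matrix V V ℝ)) i i = W.traceGap :=
    trace_sub_minEigenvalue W
  have hoff : ∑ p ∈ (univ : Finset V).offDiag,
      (W - W.minEigenvalue • (1 : Matrix V V ℝ)) p.1 p.2 * inner ℝ (u p.1) (u p.2) ≤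
      ∑ p ∈ (univ : Finset V).offDiag, W p.1 p.2 * -(1 / (k - 1)) := by
    refine sum_le_sum fun p hp ↦ ?_
    have hne : p.1 ≠ p.2 := (mem_offDiag.1 hp).2.2
    simp only [Matrix.sub_apply, Matrix.smul_apply, one_apply_ne hne, smul_zero, sub_zero]
    by_cases hadj : G.Adj p.1 p.2
    · exact mul_le_mul_of_nonneg_left (hu.inner_le _ _ hadj) (hW.nonneg _ _)
    · simp [hW.eq_zero _ _ hne hadj]
  rw [← sum_mul] at hoff
  rw [htr] at h
  have h' : (∑ p ∈ (univ : Finset V).offDiag, W p.1 p.2) * (1 / (k - 1)) ≤ W.traceGap := by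
    linarith
  rwa [mul_one_div, div_le_iff₀ hk0, mul_comm] at h'

lemma IsNonnegWeightMatrix.weightRatio_le {W : Matrix V V ℝ} (hW : G.IsNonnegWeightMatrix W)
    (hgap : W.traceGap ≠ 0) {k : ℝ} (hk : G.VectorColorable k) : W.weightRatio ≤ k - 1 := by
  rw [weightRatio, div_le_iff₀ (hW.isSymm.traceGap_nonneg.lt_of_ne' hgap)]
  exact hW.offDiag_sum_le hk

/-! ### Strong duality -/

lemma nonneg_of_forall_sub_mul_lt {a b u : ℝ} (h : ∀ c : ℝ, 0 ≤ c → a - c * b < u) : 0 ≤ b := by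
  by_contra! hb
  have h0 := h 0 le_rfl
  have h1 := h ((u - a) / -b) (div_nonneg (by linarith) (by linarith))
  have h2 : (u - a) / -b * b = -(u - a) := by
    rw [div_neg, neg_mul, div_mul_cancel₀ _ hb.ne]
  linarith

/-- If no positive semidefinite matrix has diagonal entries `< 1` and edge entries `< t`, then a
positive semidefinite weight matrix certifies this. -/
lemma exists_posSemidef_weight {t : ℝ} (ht : t < 0)
    (h : ∀ X : Matrix V V ℝ, X.PosSemidef → (∀ i, X i i < 1) → ∃ i j, G.Adj i j ∧ t ≤ X i j) :
    ∃ W : Matrix V V ℝ, G.IsNonnegWeightMatrix W ∧ W.PosSemidef ∧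
      0 < ∑ p ∈ (univ : Finset V).offDiag, W p.1 p.2 ∧
      W.trace ≤ -t * ∑ p ∈ (univ : Finset V).offDiag, W p.1 p.2 := by
  set B : Set (V → V → ℝ) := {M | (∀ i, M i i < 1) ∧ ∀ i j, G.Adj i j → M i j < t} with hB
  have hBconv : Convex ℝ B := by
    rw [hB]
    simp only [Set.ofPred_and, Set.ofPred_forall]
    refine (convex_iInter fun i ↦ convex_halfSpace_lt ?_ _).inter
      (convex_iInter fun i ↦ convex_iInter fun j ↦ convex_iInter fun _ ↦
        convex_halfSpace_lt ?_ _)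
    all_goals exact ⟨fun _ _ ↦ rfl, fun _ _ ↦ rfl⟩
  have hBopen : IsOpen B := by
    rw [hB]
    simp only [Set.ofPred_and, Set.ofPred_forall]
    refine (isOpen_iInter_of_finite fun i ↦ isOpen_lt ?_ continuous_const).inter
      (isOpen_iInter_of_finite fun i ↦ isOpen_iInter_of_finite fun j ↦
        isOpen_iInter_of_finite fun _ ↦ isOpen_lt ?_ continuous_const)
    all_goals fun_prop
  have hAconv : Convex ℝ {X : V → V → ℝ | (of X).PosSemidef} :=
    fun _ hX _ hY _ _ ha hb _ ↦ (PosSemidef.smul hX ha).add (PosSemidef.smul hY hb)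
  have hdisj : Disjoint B {X : V → V → ℝ | (of X).PosSemidef} := by
    refine Set.disjoint_left.2 fun X hXB hX ↦ ?_
    obtain ⟨i, j, hij, hle⟩ := h (of X) hX hXB.1
    exact (hXB.2 i j hij).not_ge hle
  obtain ⟨f, u, hfB, hfA⟩ := geometric_hahn_banach_open hBconv hBopen hAconv hdisj
  set F : V → V → ℝ := fun i j ↦ f (Pi.single i (Pi.single j 1))
  have hfF : ∀ X, f X = ∑ i, ∑ j, F i j * X i j := apply_eq_sum_sum f
  have hu : u ≤ 0 := by
    simpa using hfA 0 (show (of 0 : Matrix V V ℝ).PosSemidef from PosSemidef.zero)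
  have hentry : ∀ i j k l, (Pi.single i (Pi.single j 1) : V → V → ℝ) k l =
      if k = i ∧ l = j then 1 else 0 := fun i j k l ↦ by
    by_cases hk : k = i <;> by_cases hl : l = j <;> simp [hk, hl]
  -- Lowering any entry stays within `B`, and so does any change of an off-diagonal
  -- non-edge entry.
  have hF0 : ∀ i j, 0 ≤ F i j := fun i j ↦ by
    refine nonneg_of_forall_sub_mul_lt (a := f fun _ _ ↦ t - 1) (u := u) fun c hc ↦ ?_
    have hmem : ((fun _ _ ↦ t - 1) - c • (Pi.single i (Pi.single j 1) : V → V → ℝ) :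
        V → V → ℝ) ∈ B := by
      constructor <;> intros <;>
      · simp only [Pi.sub_apply, Pi.smul_apply, hentry, smul_eq_mul]
        split_ifs <;> linarith
    simpa using hfB _ hmem
  have hFz : ∀ i j, i ≠ j → ¬ G.Adj i j → F i j = 0 := fun i j hij hadj ↦ by
    refine le_antisymm (neg_nonneg.1 ?_) (hF0 i j)
    refine nonneg_of_forall_sub_mul_lt (a := f fun _ _ ↦ t - 1) (u := u) fun c hc ↦ ?_
    have hmem : ((fun _ _ ↦ t - 1) + c • (Pi.single i (Pi.single j 1) : V → V → ℝ) :
        V → V → ℝ) ∈ B := by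
      constructor
      · intro k
        have : ¬ (k = i ∧ k = j) := fun ⟨h1, h2⟩ ↦ hij (h1.symm.trans h2)
        simp only [Pi.add_apply, Pi.smul_apply, hentry, smul_eq_mul, if_neg this]
        linarith
      · intro k l hkl
        have : ¬ (k = i ∧ l = j) := by rintro ⟨rfl, rfl⟩; exact hadj hkl
        simp only [Pi.add_apply, Pi.smul_apply, hentry, smul_eq_mul, if_neg this]
        linarith
    simpa using hfB _ hmem
  -- On the rank one matrices `c • x xᵀ`, the functional `f` is at least `u` for all `c ≥ 0`.
  have hFpsd : ∀ x : V → ℝ, 0 ≤ ∑ i, ∑ j, F i j * (x i * x j) := fun x ↦ by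
    refine nonneg_of_forall_sub_mul_lt (a := 0) (u := -u + 1) fun c hc ↦ ?_
    have hmem : (of (c • fun i j ↦ x i * x j : V → V → ℝ)).PosSemidef := by
      have h1 : (of (c • fun i j ↦ x i * x j : V → V → ℝ)) = c • vecMulVec x (star x) := by
        ext i j
        simp [vecMulVec_apply]
      rw [h1]
      exact (posSemidef_vecMulVec_self_star x).smul hc
    have h2 := hfA _ hmem
    rw [map_smul, hfF, smul_eq_mul] at h2
    linarith
  set T := ∑ i, F i i with hT
  set S := ∑ p ∈ (univ : Finset V).offDiag, F p.1 p.2 with hS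
  have hT0 : 0 ≤ T := sum_nonneg fun i _ ↦ hF0 i i
  have hS0 : 0 ≤ S := sum_nonneg fun p _ ↦ hF0 _ _
  -- The value of `f` near the corner of `B` with diagonal entries `1` and other entries `t`.
  have hε : ∀ ε > 0, T + t * S - ε * (T + S) < 0 := fun ε hε ↦ by
    have hmem : (fun i j ↦ (if i = j then 1 else t) - ε : V → V → ℝ) ∈ B := by
      constructor
      · intro i
        simpa using hε
      · intro i j hij
        simpa [hij.ne] using hε
    have h1 := (hfB _ hmem).trans_le hu
    rw [hfF, sum_sum_eq_sum_diag_add_sum_offDiag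
      (fun i j ↦ F i j * ((if i = j then 1 else t) - ε))] at h1
    have h2 : ∑ p ∈ (univ : Finset V).offDiag, F p.1 p.2 * ((if p.1 = p.2 then 1 else t) - ε) =
        S * (t - ε) := by
      rw [hS, sum_mul]
      refine sum_congr rfl fun p hp ↦ ?_
      rw [if_neg (mem_offDiag.1 hp).2.2]
    simp only [if_true, h2, ← sum_mul, ← hT] at h1
    linarith
  have hSpos : 0 < S := by
    refine hS0.lt_of_ne' fun h0 ↦ ?_
    have h1 := hε 1 one_pos
    rw [h0] at h1
    linarith
  have hTS : T + t * S ≤ 0 := by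
    by_contra! hpos
    have h1 := hε ((T + t * S) / (T + S)) (div_pos hpos (by linarith))
    rw [div_mul_cancel₀ _ (by linarith)] at h1
    linarith
  have hS' : ∑ p ∈ (univ : Finset V).offDiag, F p.2 p.1 = S := by
    refine sum_nbij' Prod.swap Prod.swap ?_ ?_ ?_ ?_ ?_ <;> simp [ne_comm]
  have hWoff : ∑ p ∈ (univ : Finset V).offDiag, (of F + (of F)ᵀ) p.1 p.2 = 2 * S := by
    simp only [Matrix.add_apply, transpose_apply, of_apply, sum_add_distrib, hS', ← hS]
    ring
  have hWsymm : (of F + (of F)ᵀ).IsSymm := isSymm_add_transpose_self _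
  refine ⟨of F + (of F)ᵀ,
    ⟨hWsymm, fun i j ↦ add_nonneg (hF0 i j) (hF0 j i), fun i j hij hadj ↦ ?_⟩,
    .of_sum_mul_nonneg hWsymm fun x ↦ ?_, ?_, ?_⟩
  · simp [hFz i j hij hadj, hFz j i hij.symm fun h ↦ hadj h.symm]
  · simp only [Matrix.add_apply, transpose_apply, of_apply, add_mul, sum_add_distrib]
    refine add_nonneg (hFpsd x) ?_
    rw [sum_comm]
    refine (hFpsd x).trans_eq (sum_congr rfl fun i _ ↦ sum_congr rfl fun j _ ↦ ?_)
    rw [mul_comm (x i)]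
  · rw [hWoff]
    linarith
  · have htr : (of F + (of F)ᵀ).trace = 2 * T := by
      rw [trace_add, trace_transpose, ← two_mul]
      rfl
    rw [hWoff, htr]
    linarith

/-- A weight matrix whose quotient reaches the vector chromatic number minus one. -/
lemma exists_le_weightRatio (hG : G ≠ ⊥) : ∃ W : Matrix V V ℝ,
    G.IsNonnegWeightMatrix W ∧ W.traceGap ≠ 0 ∧ G.vectorChromaticNumber - 1 ≤ W.weightRatio := by
  obtain ⟨a, b, hab⟩ := ne_bot_iff_exists_adj.1 hG
  have hleast := isLeast_vectorChromaticNumber hG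
  set χ := G.vectorChromaticNumber
  have hχ : 0 < χ - 1 := by
    have := hleast.1.1
    linarith
  have ht : -(1 / (χ - 1)) < 0 := by
    have := one_div_pos.2 hχ
    linarith
  obtain ⟨W, hW, hpsd, hS, htr⟩ := exists_posSemidef_weight (G := G) ht fun X hX hdiag ↦ by
    by_contra! hadj
    obtain ⟨k, hk, hcol⟩ := exists_vectorColorable_lt hX hdiag hab ht hadj
    refine (hleast.2 hcol).not_gt (hk.trans_eq ?_)
    field_simp
    ring
  have hgap : 0 < W.traceGap := by
    obtain ⟨p, hp, hne⟩ := exists_ne_zero_of_sum_ne_zero hS.ne'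
    exact hW.isSymm.traceGap_pos (mem_offDiag.1 hp).2.2 hne
  refine ⟨W, hW, hgap.ne', ?_⟩
  rw [neg_neg, one_div_mul_eq_div, le_div_iff₀ hχ] at htr
  rw [weightRatio, le_div_iff₀ hgap, mul_comm]
  refine le_trans (mul_le_mul_of_nonneg_right ?_ hχ.le) htr
  have := mul_nonneg (Nat.cast_nonneg (α := ℝ) (Fintype.card V)) hpsd.minEigenvalue_nonneg
  rw [traceGap]
  linarith

/-! ### The signless Laplacian -/

section SignlessLaplacian

variable (G) [DecidableRel G.Adj]

lemma signlessLapMatrix_apply_of_ne {i j : V} (hij : i ≠ j) :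
    G.signlessLapMatrix i j = G.adjMatrix ℝ i j := by
  simp [signlessLapMatrix, degMatrix, hij]

lemma isNonnegWeightMatrix_signlessLapMatrix : G.IsNonnegWeightMatrix G.signlessLapMatrix where
  isSymm := (G.isSymm_degMatrix (R := ℝ)).add (G.isSymm_adjMatrix (α := ℝ))
  nonneg i j := by
    by_cases hij : i = j
    · subst hij
      simp [signlessLapMatrix, degMatrix]
    · rw [signlessLapMatrix_apply_of_ne G hij, adjMatrix_apply]
      split_ifs <;> simp
  eq_zero i j hij hadj := by
    rw [signlessLapMatrix_apply_of_ne G hij, adjMatrix_apply, if_neg hadj]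

lemma trace_signlessLapMatrix : G.signlessLapMatrix.trace = 2 * (G.edgeFinset.card : ℝ) := by
  rw [← Nat.cast_ofNat, ← Nat.cast_mul, ← sum_degrees_eq_twice_card_edges, Nat.cast_sum]
  simp [signlessLapMatrix, degMatrix, trace_add, trace_diagonal]

lemma offDiag_sum_signlessLapMatrix :
    ∑ p ∈ (univ : Finset V).offDiag, G.signlessLapMatrix p.1 p.2 =
      2 * (G.edgeFinset.card : ℝ) := by
  have h := sum_sum_eq_sum_diag_add_sum_offDiag (G.adjMatrix ℝ)
  simp only [adjMatrix_apply, G.irrefl, if_false, sum_const_zero, zero_add] at h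
  rw [← Nat.cast_ofNat, ← Nat.cast_mul, ← sum_degrees_eq_twice_card_edges, Nat.cast_sum]
  refine Eq.trans (sum_congr rfl fun p hp ↦ ?_) (h.symm.trans (sum_congr rfl fun i _ ↦ ?_))
  · rw [signlessLapMatrix_apply_of_ne G (mem_offDiag.1 hp).2.2, adjMatrix_apply]
  · simp [← card_neighborFinset_eq_degree, neighborFinset_eq_filter]

lemma weightRatio_signlessLapMatrix : G.signlessLapMatrix.weightRatio =
    2 * (G.edgeFinset.card : ℝ) / (2 * (G.edgeFinset.card : ℝ) -
      (Fintype.card V : ℝ) * G.signlessLapMatrix.minEigenvalue) := by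
  rw [weightRatio, traceGap, offDiag_sum_signlessLapMatrix, trace_signlessLapMatrix]

lemma traceGap_signlessLapMatrix_ne_zero (hG : G ≠ ⊥) : G.signlessLapMatrix.traceGap ≠ 0 := by
  obtain ⟨a, b, hab⟩ := ne_bot_iff_exists_adj.1 hG
  refine (G.isNonnegWeightMatrix_signlessLapMatrix.isSymm.traceGap_pos hab.ne ?_).ne'
  simp [signlessLapMatrix_apply_of_ne G hab.ne, hab]

end SignlessLaplacian

end SimpleGraph

theorem theorem2 {V : Type*} [Fintype V] [DecidableEq V] (G : SimpleGraph V)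
    [DecidableRel G.Adj] (hG : G ≠ ⊥) :
    -- the minimum that defines the vector chromatic number is attained
    IsLeast {k : ℝ | G.VectorColorable k} G.vectorChromaticNumber ∧
    -- the characterization, with an attained maximum
    (∃ M : ℝ,
      IsGreatest {r : ℝ | ∃ W : Matrix V V ℝ,
        G.IsNonnegWeightMatrix W ∧ W.traceGap ≠ 0 ∧ r = W.weightRatio} M ∧
      G.vectorChromaticNumber = 1 + M) ∧
    -- the signless Laplacian is admissible and gives the bound in terms of its least eigenvalue
    (G.IsNonnegWeightMatrix G.signlessLapMatrix ∧
      G.signlessLapMatrix.traceGap ≠ 0 ∧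
      G.signlessLapMatrix.weightRatio =
        2 * (G.edgeFinset.card : ℝ) /
          (2 * (G.edgeFinset.card : ℝ) -
            (Fintype.card V : ℝ) * G.signlessLapMatrix.minEigenvalue) ∧
      1 + 2 * (G.edgeFinset.card : ℝ) /
          (2 * (G.edgeFinset.card : ℝ) -
            (Fintype.card V : ℝ) * G.signlessLapMatrix.minEigenvalue) ≤
        G.vectorChromaticNumber) := by
  have hleast := SimpleGraph.isLeast_vectorChromaticNumber hG
  have hQ := G.isNonnegWeightMatrix_signlessLapMatrix
  have hgap := G.traceGap_signlessLapMatrix_ne_zero hG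
  refine ⟨hleast, ⟨G.vectorChromaticNumber - 1, ⟨?_, ?_⟩, by ring⟩, hQ, hgap,
    G.weightRatio_signlessLapMatrix, ?_⟩
  · obtain ⟨W, hW, hWgap, hle⟩ := SimpleGraph.exists_le_weightRatio hG
    exact ⟨W, hW, hWgap, hle.antisymm (hW.weightRatio_le hWgap hleast.1)⟩
  · rintro _ ⟨W, hW, hWgap, rfl⟩
    exact hW.weightRatio_le hWgap hleast.1
  · rw [← G.weightRatio_signlessLapMatrix]
    have := hQ.weightRatio_le hgap hleast.1
    linarith
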